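/- Let $D$ be a probability distribution on $\mathcal X\times[m]$, where $\mathcal X$ is a measurable space and $m\ge 1$; let $D_{\mathcal X}$ be its marginal on $\mathcal X$ and $p^*_y(x)=\Pr(Y=y\mid X=x)$ the conditional class probabilities, so that $\mathbf p^*(x)\in\Delta^m$, the probability simplex in $\mathbb R^m$. For a classifier $h:\mathcal X\to[m]$ put $R(h)=\mathbb E_{(x,y)\sim D}[\mathbf 1(h(x)\neq y)]$, and let $h^*(x)=\operatorname{argmax}_y p^*_y(x)$ be the Bayes-optimal classifier; in every argmax, ties are broken in favor of the larger class. Let $\mathbf p^t:\mathcal X\to\Delta^m$ be a fixed measurable teacher, $\ell_h(x)=\sum_{i=1}^m p^t_i(x)\mathbf 1(h(x)\ne i)$, and $R^t(h)=\mathbb E_{x\sim D_{\mathcal X}}[\ell_h(x)]$. Let $\phi:\Delta^m\to\Delta^m$ be such that $\mathbf p^\phi(x)=\phi(\mathbf p^*(x))$ is $D_{\mathcal X}$-almost everywhere measurable and, for $D_{\mathcal X}$-almost every $x$, $$\operatorname{argmax}_y p^\phi_y(x)=\operatorname{argmax}_y p^*_y(x),\qquad \max_i p^\phi_i(x)-p^\phi_j(x)\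 \ge\ \max_i p^*_i(x)-p^*_j(x)\quad\forall j\in[m].$$ Let $\mathcal H$ be a class of measurable functions $\mathcal X\to[m]$ of Natarajan dimension $d<\infty$, that is, $d$ is the largest size of a finite set $S\subseteq\mathcal X$ for which there are $f,g:\mathcal X\to[m]$ with $f(x)\ne g(x)$ for all $x\in S$ such that for every $T\subseteq S$ some $h\in\mathcal H$ agrees with $f$ on $T$ and with $g$ on $S\setminus T$ (with $d=0$ if $\mathcal H=\emptyset$). Assume that the loss class $\{\ell_h:h\in\mathcal H\}$ is $D_{\mathcal X}$-measurable in the usual sense of empirical process theory: for all $k$ and $e\in\mathbb R^k$, the map $(x_1,\dots,x_k)\mapsto\sup_{h\in\mathcal H}\left|\sum_{i=1}^k e_i\,\ell_h(x_i)\right|$ is measurable for the completion of $D_{\mathcal X}^{k}$ (as is the case, for instance, if $\mathcal H$ is countable). Then there is a universal constant $C>0$, independent of all of the above, such that for every $\delta\in(0,1)$ and every $n^u\ge1$, with probability at least $1-\delta$ over the draw of $n^u$ independent unlabeled examples $S^u=(x_1,\dots,x_{n^u})$ from $D_{\mathcal X}$, every solution $\hat h\in\mathcal H$ of the student empirical risk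 minimization problem $$\min_{h\in\mathcal H}\ \frac1{n^u}\sum_{k=1}^{n^u}\sum_{i=1}^m p^t_i(x_k)\,\mathbf 1(h(x_k)\ne i)$$ satisfies $$R(\hat h)-R(h^*)\ \le\ C\sqrt{\frac{d\log(m n^u)+\log(1/\delta)}{n^u}}\;+\;\inf_{h\in\mathcal H}R^t(h)-\inf_{h:\mathcal X\to[m]}R^t(h)\;+\;\mathbb E_{x\sim D_{\mathcal X}}\left[\|\mathbf p^t(x)-\mathbf p^\phi(x)\|_1\right],$$ where the second infimum is over all measurable $h:\mathcal X\to[m]$. ("With probability at least $1-\delta$" means that the failure event has outer probability at most $\delta$.) -/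

import Mathlib

open MeasureTheory ProbabilityTheory

universe u

noncomputable section

namespace Distill

/-- Index of the largest coordinate, ties being broken in favor of the larger index. -/
def argmaxLast {m : ℕ} [NeZero m] (p : Fin m → ℝ) : Fin m :=
  (Finset.univ.filter fun i => ∀ j, p j ≤ p i).max' (by
    obtain ⟨i, hi⟩ := Finite.exists_max p
    exact ⟨i, by simpa using hi⟩)

variable {X : Type u} [MeasurableSpace X] {m : ℕ}

/-- The conditional class probabilities `x ↦ (Pr(Y = y | X = x))_y` of a distribution `D` on
instances and labels, through the disintegration of `D` along its first marginal `D.fst`. -/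
def condClassProb [NeZero m] (D : Measure (X × Fin m)) [IsFiniteMeasure D] (x : X) :
    stdSimplex ℝ (Fin m) :=
  ⟨fun y => (D.condKernel x).real {y}, fun _ => measureReal_nonneg, by
    rw [sum_measureReal_singleton, Finset.coe_univ, probReal_univ]⟩

/-- The Bayes-optimal classifier. -/
def bayes [NeZero m] (D : Measure (X × Fin m)) [IsFiniteMeasure D] (x : X) : Fin m :=
  argmaxLast (condClassProb D x).1

/-- The expected 0-1 risk. -/
def risk (D : Measure (X × Fin m)) (h : X → Fin m) : ℝ :=
  ∫ z, (if h z.1 ≠ z.2 then (1 : ℝ) else 0) ∂D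

/-- The loss at `x` of the student `h` on the soft labels of the teacher `pt`. -/
def distilledLoss (pt : X → stdSimplex ℝ (Fin m)) (h : X → Fin m) (x : X) : ℝ :=
  ∑ i, (pt x).1 i * (if h x ≠ i then 1 else 0)

/-- The expected teacher-distilled risk with respect to the instance distribution `P`. -/
def distilledRisk (P : Measure X) (pt : X → stdSimplex ℝ (Fin m)) (h : X → Fin m) : ℝ :=
  ∫ x, distilledLoss pt h x ∂P

/-- The empirical teacher-distilled risk on the sample `S`. -/
def empiricalRisk {n : ℕ} (pt : X → stdSimplex ℝ (Fin m)) (S : Fin n → X) (h : X → Fin m) : ℝ :=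
  (1 / (n : ℝ)) * ∑ k, distilledLoss pt h (S k)

/-- `h` solves the empirical risk minimization problem over the class `H` on the sample `S`. -/
def IsERM {n : ℕ} (H : Set (X → Fin m)) (pt : X → stdSimplex ℝ (Fin m)) (S : Fin n → X)
    (h : X → Fin m) : Prop :=
  h ∈ H ∧ ∀ g ∈ H, empiricalRisk pt S h ≤ empiricalRisk pt S g

/-- `H` shatters the finite set `S` in the sense of Natarajan. -/
def NShatters {X : Type u} {m : ℕ} (H : Set (X → Fin m)) (S : Finset X) : Prop :=
  ∃ f g : X → Fin m, (∀ x ∈ S, f x ≠ g x) ∧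
    ∀ T ⊆ S, ∃ h ∈ H, (∀ x ∈ T, h x = f x) ∧ ∀ x ∈ S, x ∉ T → h x = g x

/-- The Natarajan dimension: the supremum of the sizes of the N-shattered finite sets. -/
def natarajanDim {X : Type u} {m : ℕ} (H : Set (X → Fin m)) : ℕ∞ :=
  ⨆ (S : Finset X) (_ : NShatters H S), (S.card : ℕ∞)

/-- `F` is a `P`-measurable class (van der Vaart and Wellner): for all `n` and all weights `e`,
the map `(x₁, …, xₙ) ↦ sup_{f ∈ F} |∑ eᵢ f(xᵢ)|` is measurable for the completion of `Pⁿ`. -/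
def IsMeasurableClass (P : Measure X) (F : Set (X → ℝ)) : Prop :=
  ∀ (n : ℕ) (e : Fin n → ℝ),
    AEMeasurable (fun s : Fin n → X => ⨆ f ∈ F, ENNReal.ofReal |∑ i, e i * f (s i)|)
      (Measure.pi fun _ => P)

end Distill

end

namespace Distill

/-! Approximation. At a point where `h` differs from `h*`, its excess loss is the margin `p*_{h*} -
p*_h`. The hypotheses on `φ` bound it by the same margin of `p^φ`, and replacing `p^φ` by the
teacher changes two distinct coordinates, which costs at most the ℓ¹ distance. Integrating gives
`risk_sub_risk_bayes_le`; `h*` is itself a competitor in the infimum over all measurable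
classifiers.

Estimation. An empirical minimizer exceeds the infimum of `R^t` over `H` by at most twice the
uniform deviation. That deviation is bounded by the classical argument: a ghost sample
(`measure_exists_abs_sum_sub_le`), random exchanges between the two samples, and Hoeffding with a
union bound over patterns (`measure_double_sample_le`). The loss at a point depends on `h` only
through its label there, so Natarajan's lemma (`exists_cover_of_nshatters_card_le`) leaves at most
`((2n+1)m²)^d` patterns on a double sample. -/

/-! ### Natarajan's lemma -/

/-- Two members of `H` that differ at `x` witness that `{x}` is N-shattered. -/
theorem nshatters_singleton {X : Type u} {m : ℕ} {H : Set (X → Fin m)} {h h' : X → Fin m}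
    (hh : h ∈ H) (hh' : h' ∈ H) {x : X} (hx : h x ≠ h' x) : NShatters H {x} := by
  refine ⟨h, h', by simpa using hx, fun T hT => ?_⟩
  rcases Finset.subset_singleton_iff.1 hT with rfl | rfl
  · exact ⟨h', hh', by simp, by simp⟩
  · exact ⟨h, hh, by simp, by simp⟩

/-- The members of `H` with value `a` at `x` whose modification at `x` to the value `b` agrees
on `S` with a member of `H`. -/
def twoValued {X : Type u} {m : ℕ} (H : Set (X → Fin m)) (S : Finset X) (x : X) (a b : Fin m) :
    Set (X → Fin m) :=
  {h | h ∈ H ∧ h x = a ∧ ∃ h' ∈ H, h' x = b ∧ ∀ y ∈ S, h' y = h y}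

/-- Every pattern on `T` is realized by a member with value `a` at `x` and also by its twin with
value `b`, so the choice at `x` is free. Hence passing to `twoValued` lowers the dimension bound by
one. -/
theorem NShatters.insert_of_twoValued {X : Type u} [DecidableEq X] {m : ℕ} {H : Set (X → Fin m)}
    {S T : Finset X} {x : X} (hx : x ∉ S) {a b : Fin m} (hab : a ≠ b) (hT : T ⊆ S)
    (h : NShatters (twoValued H S x a b) T) : NShatters H (insert x T) := by
  obtain ⟨f, g, hfg, hs⟩ := h
  have hne : ∀ y ∈ T, y ≠ x := fun y hy e => hx (e ▸ hT hy)
  refine ⟨Function.update f x a, Function.update g x b, ?_, fun U hU => ?_⟩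
  · intro y hy
    rcases Finset.mem_insert.1 hy with rfl | hy
    · simpa using hab
    · simpa [Function.update_of_ne (hne y hy)] using hfg y hy
  · obtain ⟨h, ⟨hH, hxa, h', hH', hxb, hag⟩, h1, h2⟩ := hs (U.erase x) (by
      intro y hy
      have := Finset.mem_erase.1 hy
      exact (Finset.mem_insert.1 (hU this.2)).resolve_left this.1)
    by_cases hxU : x ∈ U
    · refine ⟨h, hH, fun y hy => ?_, fun y hy hyU => ?_⟩
      · by_cases e : y = x
        · subst e; simpa using hxa
        · rw [Function.update_of_ne e]; exact h1 y (Finset.mem_erase.2 ⟨e, hy⟩)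
      · have e : y ≠ x := fun e => hyU (e ▸ hxU)
        rw [Function.update_of_ne e]
        exact h2 y ((Finset.mem_insert.1 hy).resolve_left e)
          (fun hh => hyU (Finset.mem_of_mem_erase hh))
    · refine ⟨h', hH', fun y hy => ?_, fun y hy hyU => ?_⟩
      · have e : y ≠ x := fun e => hxU (e ▸ hy)
        have hyT := (Finset.mem_insert.1 (hU hy)).resolve_left e
        rw [Function.update_of_ne e, hag y (hT hyT)]
        exact h1 y (Finset.mem_erase.2 ⟨e, hy⟩)
      · by_cases e : y = x
        · subst e; simpa using hxb
        · have hyT := (Finset.mem_insert.1 hy).resolve_left e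
          rw [Function.update_of_ne e, hag y (hT hyT)]
          exact h2 y hyT (fun hh => hyU (Finset.mem_of_mem_erase hh))

/-- Natarajan's lemma: if `H` N-shatters no subset of `S` of more than `d` points, then at most
`((|S| + 1) m²) ^ d` members of `H` represent all the restrictions of `H` to `S`. -/
theorem exists_cover_of_nshatters_card_le {X : Type u} {m : ℕ} [NeZero m] (S : Finset X) :
    ∀ (H : Set (X → Fin m)) (d : ℕ), (∀ T ⊆ S, NShatters H T → T.card ≤ d) →
      ∃ G : Finset (X → Fin m), (∀ g ∈ G, g ∈ H) ∧ G.card ≤ ((S.card + 1) * m ^ 2) ^ d ∧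
        ∀ h ∈ H, ∃ g ∈ G, ∀ x ∈ S, g x = h x := by
  classical
  have hm : 0 < m := Nat.pos_of_neZero m
  induction S using Finset.induction_on with
  | empty =>
    intro H d _
    rcases H.eq_empty_or_nonempty with rfl | ⟨h₀, hh₀⟩
    · exact ⟨∅, by simp, by simp, by simp⟩
    · refine ⟨{h₀}, by simpa using hh₀, ?_, by simp⟩
      rw [Finset.card_singleton]
      exact Nat.one_le_pow _ _ (by positivity)
  | insert x S hx ih =>
    intro H d hd
    -- With bound `0` no two members differ on the set, so one representative suffices.
    rcases d with _ | e
    · rcases H.eq_empty_or_nonempty with rfl | ⟨h₀, hh₀⟩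
      · exact ⟨∅, by simp, by simp, by simp⟩
      · refine ⟨{h₀}, by simpa using hh₀, by simp, fun h hh => ⟨h₀, by simp, fun y hy => ?_⟩⟩
        by_contra hne
        simpa using hd {y} (by simpa using hy) (nshatters_singleton hh₀ hh hne)
    · obtain ⟨G₀, hG₀, hc₀, hcov₀⟩ := ih H (e + 1)
        (fun T hT => hd T (hT.trans (Finset.subset_insert _ _)))
      -- Each of the `m²` pairs of values contributes a cover of a class with the smaller bound `e`;
      -- diagonal pairs get the empty cover.
      have key : ∀ p : Fin m × Fin m, ∃ G : Finset (X → Fin m), (∀ g ∈ G, g ∈ H) ∧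
          G.card ≤ ((S.card + 1) * m ^ 2) ^ e ∧ (p.1 ≠ p.2 →
            ∀ h ∈ twoValued H S x p.1 p.2, ∃ g ∈ G, g x = p.1 ∧ ∀ y ∈ S, g y = h y) := by
        rintro ⟨a, b⟩
        by_cases hab : a = b
        · exact ⟨∅, by simp, by simp, fun h => absurd hab h⟩
        · obtain ⟨G, hG, hc, hcov⟩ := ih (twoValued H S x a b) e (fun T hT hsh => by
            have := hd _ (Finset.insert_subset_insert x hT) (hsh.insert_of_twoValued hx hab hT)
            rw [Finset.card_insert_of_notMem (fun h => hx (hT h))] at this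
            omega)
          refine ⟨G, fun g hg => (hG g hg).1, hc, fun _ h hh => ?_⟩
          obtain ⟨g, hg, hgh⟩ := hcov h hh
          exact ⟨g, hg, (hG g hg).2.1, hgh⟩
      choose G hG hc hcov using key
      refine ⟨G₀ ∪ Finset.univ.biUnion G, ?_, ?_, ?_⟩
      · intro g hg
        rcases Finset.mem_union.1 hg with hg | hg
        · exact hG₀ g hg
        · obtain ⟨p, -, hp⟩ := Finset.mem_biUnion.1 hg
          exact hG p g hp
      · have h1 : (Finset.univ.biUnion G).card ≤ m ^ 2 * ((S.card + 1) * m ^ 2) ^ e := by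
          refine (Finset.card_biUnion_le_card_mul _ _ _ (fun p _ => hc p)).trans (le_of_eq ?_)
          simp [sq]
        rw [Finset.card_insert_of_notMem hx]
        calc (G₀ ∪ Finset.univ.biUnion G).card
            ≤ ((S.card + 1) * m ^ 2) ^ (e + 1) + m ^ 2 * ((S.card + 1) * m ^ 2) ^ e :=
              (Finset.card_union_le _ _).trans (add_le_add hc₀ h1)
          _ = ((S.card + 1) * m ^ 2) ^ e * ((S.card + 1 + 1) * m ^ 2) := by ring
          _ ≤ ((S.card + 1 + 1) * m ^ 2) ^ e * ((S.card + 1 + 1) * m ^ 2) := by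
              gcongr; omega
          _ = _ := (pow_succ _ _).symm
      · intro h hh
        obtain ⟨g, hg, hgh⟩ := hcov₀ h hh
        -- If the representative on `S` is wrong at `x`, it is itself the twin that puts `h` in
        -- `twoValued H S x (h x) (g x)`.
        by_cases hgx : g x = h x
        · refine ⟨g, Finset.mem_union_left _ hg, fun y hy => ?_⟩
          rcases Finset.mem_insert.1 hy with rfl | hy
          exacts [hgx, hgh y hy]
        · obtain ⟨g', hg', hx', hgh'⟩ := hcov (h x, g x) (Ne.symm hgx) h
            ⟨hh, rfl, g, hG₀ g hg, rfl, hgh⟩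
          refine ⟨g', Finset.mem_union_right _ (Finset.mem_biUnion.2 ⟨_, Finset.mem_univ _, hg'⟩),
            fun y hy => ?_⟩
          rcases Finset.mem_insert.1 hy with rfl | hy
          exacts [hx', hgh' y hy]

theorem NShatters.card_le {X : Type u} {m : ℕ} {H : Set (X → Fin m)} {d : ℕ}
    (hd : natarajanDim H = d) {T : Finset X} (hT : NShatters H T) : T.card ≤ d := by
  have h : (T.card : ℕ∞) ≤ natarajanDim H :=
    le_iSup₂ (f := fun (S : Finset X) (_ : NShatters H S) => (S.card : ℕ∞)) T hT
  rw [hd] at h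
  exact_mod_cast h

/-! ### Hoeffding's inequality for random signs -/

/-- The upper tail of a weighted sum of independent random signs. -/
theorem card_sign_sum_gt {ι : Type*} [Fintype ι] [DecidableEq ι] [Nonempty ι] (a : ι → ℝ)
    (ha : ∀ i, |a i| ≤ 1) {t : ℝ} (ht : 0 ≤ t) :
    ((Finset.univ.filter fun σ : ι → Bool => t < ∑ i, (if σ i then a i else -a i)).card : ℝ)
      ≤ 2 ^ Fintype.card ι * Real.exp (-t ^ 2 / (2 * Fintype.card ι)) := by
  set N : ℝ := (Fintype.card ι : ℝ) with hN
  have hN0 : 0 < N := by rw [hN]; exact_mod_cast Fintype.card_pos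
  -- Chernoff parameter: the minimizer of `N l² / 2 - l t`.
  set l : ℝ := t / N with hl
  have hl0 : 0 ≤ l := by positivity
  have hsum : ∑ σ : ι → Bool, Real.exp (l * ∑ i, (if σ i then a i else -a i))
      ≤ 2 ^ Fintype.card ι * Real.exp (N * (l ^ 2 / 2)) := by
    have e1 : ∑ σ : ι → Bool, Real.exp (l * ∑ i, (if σ i then a i else -a i))
        = ∏ i, ∑ b : Bool, Real.exp (l * (if b then a i else -a i)) := by
      rw [Finset.prod_univ_sum, Fintype.piFinset_univ]
      refine Finset.sum_congr rfl fun σ _ => ?_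
      rw [Finset.mul_sum, Real.exp_sum]
    have e2 : ∀ i, ∑ b : Bool, Real.exp (l * (if b then a i else -a i))
        ≤ 2 * Real.exp (l ^ 2 / 2) := by
      intro i
      have h1 : ∑ b : Bool, Real.exp (l * (if b then a i else -a i))
          = 2 * Real.cosh (l * a i) := by
        rw [Real.cosh_eq]; simp; ring
      rw [h1]
      have h2 := Real.cosh_le_exp_half_sq (l * a i)
      have h3 : (l * a i) ^ 2 / 2 ≤ l ^ 2 / 2 := by
        have : (a i) ^ 2 ≤ 1 := (sq_le_one_iff_abs_le_one _).2 (ha i)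
        nlinarith [sq_nonneg l]
      have h4 := Real.exp_le_exp.2 h3
      linarith
    rw [e1]
    refine (Finset.prod_le_prod (fun i _ => Finset.sum_nonneg fun b _ => (Real.exp_pos _).le)
      (fun i _ => e2 i)).trans (le_of_eq ?_)
    rw [Finset.prod_const, Finset.card_univ, mul_pow, ← Real.exp_nat_mul]
  have h1 : ((Finset.univ.filter fun σ : ι → Bool =>
      t < ∑ i, (if σ i then a i else -a i)).card : ℝ) * Real.exp (l * t)
      ≤ ∑ σ : ι → Bool, Real.exp (l * ∑ i, (if σ i then a i else -a i)) := by
    rw [← nsmul_eq_mul]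
    refine (Finset.card_nsmul_le_sum _ (fun σ : ι → Bool =>
      Real.exp (l * ∑ i, (if σ i then a i else -a i))) _ fun σ hσ => ?_).trans
      (Finset.sum_le_sum_of_subset_of_nonneg (Finset.filter_subset _ _)
        fun _ _ _ => (Real.exp_pos _).le)
    exact Real.exp_le_exp.2 (mul_le_mul_of_nonneg_left (Finset.mem_filter.1 hσ).2.le hl0)
  have h2 := (le_div_iff₀ (Real.exp_pos _)).2 (h1.trans hsum)
  refine h2.trans (le_of_eq ?_)
  rw [mul_div_assoc, ← Real.exp_sub]
  congr 2
  rw [hl]; field_simp; ring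

/-- Hoeffding's inequality for a weighted sum of independent random signs. -/
theorem card_abs_sign_sum_gt {ι : Type*} [Fintype ι] [DecidableEq ι] [Nonempty ι] (a : ι → ℝ)
    (ha : ∀ i, |a i| ≤ 1) {t : ℝ} (ht : 0 ≤ t) :
    ((Finset.univ.filter fun σ : ι → Bool => t < |∑ i, (if σ i then a i else -a i)|).card : ℝ)
      ≤ 2 ^ Fintype.card ι * (2 * Real.exp (-t ^ 2 / (2 * Fintype.card ι))) := by
  have h1 := card_sign_sum_gt a ha ht
  have h2 := card_sign_sum_gt (fun i => -a i) (by simpa using ha) ht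
  have hsub : (Finset.univ.filter fun σ : ι → Bool => t < |∑ i, (if σ i then a i else -a i)|)
      ⊆ (Finset.univ.filter fun σ : ι → Bool => t < ∑ i, (if σ i then a i else -a i))
        ∪ (Finset.univ.filter fun σ : ι → Bool => t < ∑ i, (if σ i then -a i else - -a i)) := by
    intro σ hσ
    have e : ∑ i, (if σ i then -a i else - -a i) = -∑ i, (if σ i then a i else -a i) := by
      rw [← Finset.sum_neg_distrib]
      exact Finset.sum_congr rfl fun i _ => by split_ifs <;> rfl
    simp only [Finset.mem_union, Finset.mem_filter, Finset.mem_univ, true_and, e] at hσ ⊢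
    exact lt_abs.1 hσ
  have h3 : ((Finset.univ.filter fun σ : ι → Bool =>
      t < |∑ i, (if σ i then a i else -a i)|).card : ℝ) ≤ _ :=
    Nat.cast_le.2 ((Finset.card_le_card hsub).trans (Finset.card_union_le _ _))
  push_cast at h3
  linarith

/-! ### Symmetrization -/

theorem measurePreserving_comp_equiv {X ι ι' : Type*} [MeasurableSpace X] [Fintype ι] [Fintype ι']
    (P : Measure X) [SigmaFinite P] (e : ι' ≃ ι) :
    MeasurePreserving (fun s : ι → X => fun i => s (e i)) (Measure.pi fun _ : ι => P)
      (Measure.pi fun _ : ι' => P) := by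
  have h := measurePreserving_piCongrLeft (fun _ : ι' => P) e.symm
  have h2 : ⇑(MeasurableEquiv.piCongrLeft (fun _ : ι' => X) e.symm)
      = fun s : ι → X => fun i => s (e i) := by
    funext s i
    have := MeasurableEquiv.piCongrLeft_apply_apply e.symm (β := fun _ => X) s (e i)
    rwa [e.symm_apply_apply] at this
  rwa [h2] at h

/-- In a `P`-measurable class, the event that some weighted sum exceeds a threshold is
null-measurable, whatever the finite type that indexes the sample. -/
theorem IsMeasurableClass.nullMeasurableSet {X ι : Type*} [MeasurableSpace X] [Fintype ι]
    {P : Measure X} [IsProbabilityMeasure P] {F : Set (X → ℝ)} (hF : IsMeasurableClass P F)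
    (e : ι → ℝ) {t : ℝ} (ht : 0 ≤ t) :
    NullMeasurableSet {s : ι → X | ∃ f ∈ F, t < |∑ i, e i * f (s i)|}
      (Measure.pi fun _ => P) := by
  set c := (Fintype.equivFin ι).symm
  have h1 := hF _ (fun i => e (c i))
  have h2 : NullMeasurableSet {s : Fin (Fintype.card ι) → X |
      ∃ f ∈ F, t < |∑ i, e (c i) * f (s i)|} (Measure.pi fun _ => P) := by
    -- The strict inequality makes the event a superlevel set of the supremum.
    have h3 := h1.nullMeasurable (measurableSet_Ioi (a := ENNReal.ofReal t))
    convert h3 using 1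
    ext s
    simp only [Set.mem_ofPred_eq, Set.mem_preimage, Set.mem_Ioi, lt_iSup_iff, exists_prop]
    refine exists_congr fun f => and_congr_right fun _ => ?_
    exact (ENNReal.ofReal_lt_ofReal_iff_of_nonneg ht).symm
  have h4 := h2.preimage (measurePreserving_comp_equiv P c).quasiMeasurePreserving
  convert h4 using 1
  ext s
  simp only [Set.mem_ofPred_eq, Set.mem_preimage]
  refine exists_congr fun f => and_congr_right fun _ => ?_
  rw [← c.sum_comp]

/-- The permutation of the two halves of a double sample that exchanges the `i`-th entries
exactly where `σ i` is false. -/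
def halfSwap {ι : Type*} (σ : ι → Bool) : ι ⊕ ι ≃ ι ⊕ ι :=
  have h : Function.Involutive fun z : ι ⊕ ι => Sum.elim
      (fun i => if σ i then Sum.inl i else Sum.inr i)
      (fun i => if σ i then Sum.inr i else Sum.inl i) z := by
    rintro (i | i) <;> by_cases hi : σ i <;> simp [hi]
  h.toPerm

theorem halfSwap_inl {ι : Type*} (σ : ι → Bool) (i : ι) :
    halfSwap σ (.inl i) = if σ i then .inl i else .inr i := rfl

theorem halfSwap_inr {ι : Type*} (σ : ι → Bool) (i : ι) :
    halfSwap σ (.inr i) = if σ i then .inr i else .inl i := rfl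

/-- The symmetrized tail bound for a class with finitely many patterns on each double sample. -/
theorem measure_double_sample_le {X : Type*} [MeasurableSpace X] {n : ℕ} (hn : 0 < n)
    {P : Measure X} [IsProbabilityMeasure P] {F : Set (X → ℝ)} (hF : IsMeasurableClass P F)
    (hF01 : ∀ f ∈ F, ∀ x, f x ∈ Set.Icc (0 : ℝ) 1) {K : ℕ}
    (hK : ∀ s : Fin n ⊕ Fin n → X, ∃ G : Finset (X → ℝ), (∀ g ∈ G, g ∈ F) ∧ G.card ≤ K ∧
      ∀ f ∈ F, ∃ g ∈ G, ∀ i, g (s i) = f (s i)) {t : ℝ} (ht : 0 ≤ t) :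
    (Measure.pi fun _ : Fin n ⊕ Fin n => P)
      {s | ∃ f ∈ F, t < |∑ i, (f (s (.inl i)) - f (s (.inr i)))|}
      ≤ ENNReal.ofReal (K * (2 * Real.exp (-t ^ 2 / (2 * n)))) := by
  classical
  have : Nonempty (Fin n) := ⟨⟨0, hn⟩⟩
  set ν := (Measure.pi fun _ : Fin n ⊕ Fin n => P)
  set B : (Fin n → Bool) → Set (Fin n ⊕ Fin n → X) := fun σ =>
    {s | ∃ f ∈ F, t < |∑ i, (if σ i then f (s (.inl i)) - f (s (.inr i))
      else -(f (s (.inl i)) - f (s (.inr i))))|} with hB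
  have hBm : ∀ σ, NullMeasurableSet (B σ) ν := by
    intro σ
    have := hF.nullMeasurableSet (ι := Fin n ⊕ Fin n)
      (Sum.elim (fun i => if σ i then 1 else -1) (fun i => if σ i then -1 else 1)) ht
    convert this using 1
    ext s
    simp only [hB, Set.mem_ofPred_eq]
    refine exists_congr fun f => and_congr_right fun _ => ?_
    rw [Fintype.sum_sum_type, ← Finset.sum_add_distrib]
    refine iff_of_eq (congrArg (fun r => t < |r|) (Finset.sum_congr rfl fun i _ => ?_))
    by_cases hi : σ i <;> simp [hi] <;> ring
  -- The exchange `halfSwap σ` preserves the product measure and pulls the unsigned event back to `B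
  -- σ`.
  have hBeq : ∀ σ, ν (B σ)
      = ν {s | ∃ f ∈ F, t < |∑ i, (f (s (.inl i)) - f (s (.inr i)))|} := by
    intro σ
    have hm := hBm (fun _ => true)
    have e0 : B (fun _ => true)
        = {s | ∃ f ∈ F, t < |∑ i, (f (s (.inl i)) - f (s (.inr i)))|} := by
      simp [hB]
    rw [← e0, ← (measurePreserving_comp_equiv P (halfSwap σ)).measure_preimage hm]
    congr 1
    ext s
    simp only [hB, Set.mem_ofPred_eq, Set.mem_preimage]
    refine exists_congr fun f => and_congr_right fun _ => ?_
    refine iff_of_eq (congrArg (fun r => t < |r|) (Finset.sum_congr rfl fun i _ => ?_))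
    by_cases hi : σ i <;> simp [hi, halfSwap_inl, halfSwap_inr]
  set c : ℝ := K * (2 * Real.exp (-t ^ 2 / (2 * n)))
  have hcount : ∀ s, ((Finset.univ.filter fun σ => s ∈ B σ).card : ℝ) ≤ 2 ^ n * c := by
    intro s
    obtain ⟨G, hG, hGc, hcov⟩ := hK s
    set A : (X → ℝ) → Finset (Fin n → Bool) := fun g => Finset.univ.filter fun σ =>
      t < |∑ i, (if σ i then g (s (.inl i)) - g (s (.inr i))
        else -(g (s (.inl i)) - g (s (.inr i))))|
    have hsub : (Finset.univ.filter fun σ => s ∈ B σ) ⊆ G.biUnion A := by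
      intro σ hσ
      obtain ⟨f, hf, hlt⟩ := (Finset.mem_filter.1 hσ).2
      obtain ⟨g, hg, hgf⟩ := hcov f hf
      refine Finset.mem_biUnion.2 ⟨g, hg, Finset.mem_filter.2 ⟨Finset.mem_univ _, ?_⟩⟩
      simpa only [hgf] using hlt
    have hA : ∀ g ∈ G, ((A g).card : ℝ) ≤ 2 ^ n * (2 * Real.exp (-t ^ 2 / (2 * n))) := by
      intro g hg
      have := card_abs_sign_sum_gt (fun i : Fin n => g (s (.inl i)) - g (s (.inr i)))
        (fun i => by
          have h1 := hF01 g (hG g hg) (s (.inl i))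
          have h2 := hF01 g (hG g hg) (s (.inr i))
          exact abs_le.2 ⟨by linarith [h1.1, h2.2], by linarith [h1.2, h2.1]⟩) ht
      simpa only [Fintype.card_fin] using this
    calc ((Finset.univ.filter fun σ => s ∈ B σ).card : ℝ)
        ≤ ∑ g ∈ G, ((A g).card : ℝ) := by
          exact_mod_cast (Finset.card_le_card hsub).trans Finset.card_biUnion_le
      _ ≤ G.card * (2 ^ n * (2 * Real.exp (-t ^ 2 / (2 * n)))) := by
          rw [← nsmul_eq_mul]
          exact Finset.sum_le_card_nsmul _ _ _ hA
      _ ≤ K * (2 ^ n * (2 * Real.exp (-t ^ 2 / (2 * n)))) := by gcongr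
      _ = _ := by ring
  -- Averaging over signs under the integral: the `2 ^ n` events have equal measure, and each fixed
  -- sample lies in few of them. Exchanging sum and integral needs their null-measurability.
  have hsum : ∑ σ, ν (B σ) ≤ ENNReal.ofReal (2 ^ n * c) := by
    calc ∑ σ, ν (B σ) = ∑ σ, ∫⁻ s, (B σ).indicator 1 s ∂ν :=
          Finset.sum_congr rfl fun σ _ => (lintegral_indicator_one₀ (hBm σ)).symm
      _ = ∫⁻ s, ∑ σ, (B σ).indicator 1 s ∂ν :=
          (lintegral_finsetSum' _ fun σ _ => aemeasurable_const.indicator₀ (hBm σ)).symm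
      _ ≤ ∫⁻ _, ENNReal.ofReal (2 ^ n * c) ∂ν := by
          refine lintegral_mono fun s => ?_
          have : ∑ σ, (B σ).indicator (1 : (Fin n ⊕ Fin n → X) → ENNReal) s
              = ((Finset.univ.filter fun σ => s ∈ B σ).card : ENNReal) := by
            simp [Set.indicator_apply, Finset.sum_boole]
          rw [this, ← ENNReal.ofReal_natCast]
          exact ENNReal.ofReal_le_ofReal (hcount s)
      _ = _ := by simp
  rw [Finset.sum_congr rfl fun σ _ => hBeq σ, Finset.sum_const, Finset.card_univ,
    Fintype.card_fun, Fintype.card_bool, Fintype.card_fin, nsmul_eq_mul,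
    ENNReal.ofReal_mul (by positivity), ENNReal.ofReal_pow (by norm_num)] at hsum
  simp only [ENNReal.ofReal_ofNat, Nat.cast_pow, Nat.cast_ofNat] at hsum
  exact (ENNReal.mul_le_mul_iff_right (by positivity) (by simp)).1 hsum

/-- Chebyshev's inequality for the empirical mean of a `[0, 1]`-valued function. -/
theorem measure_half_le_abs_sum_sub_le {X : Type*} [MeasurableSpace X] {n : ℕ}
    {P : Measure X} [IsProbabilityMeasure P] {f : X → ℝ} (hf : Measurable f)
    (hf01 : ∀ x, f x ∈ Set.Icc (0 : ℝ) 1) {ε : ℝ} (hε : 0 < ε) (hnε : 2 ≤ n * ε ^ 2) :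
    (Measure.pi fun _ : Fin n => P) {S | n * ε / 2 ≤ |∑ k, f (S k) - n * ∫ x, f x ∂P|}
      ≤ 1 / 2 := by
  have hn : 0 < (n : ℝ) := by
    by_contra h
    nlinarith [sq_nonneg ε]
  have hL : ∀ _ : Fin n, MemLp f 2 P := fun _ =>
    memLp_of_bounded (ae_of_all _ hf01) hf.aestronglyMeasurable 2
  have hLk : ∀ k : Fin n, MemLp (fun S : Fin n → X => f (S k)) 2 (Measure.pi fun _ => P) :=
    fun k => (hL k).comp_measurePreserving (measurePreserving_eval _ k)
  have hmean : ∫ S : Fin n → X, (∑ k, fun S : Fin n → X => f (S k)) S ∂(Measure.pi fun _ => P)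
      = n * ∫ x, f x ∂P := by
    simp only [Finset.sum_apply]
    rw [integral_finsetSum _ fun k _ => (hLk k).integrable (by norm_num)]
    have : ∀ k : Fin n, ∫ S : Fin n → X, f (S k) ∂(Measure.pi fun _ => P) = ∫ x, f x ∂P :=
      fun k => integral_comp_eval (μ := fun _ : Fin n => P) hf.aestronglyMeasurable
    simp [this]
  have hvar := variance_sum_pi (μ := fun _ : Fin n => P) (X := fun _ => f) hL
  have hv1 : variance f P ≤ ((1 - 0) / 2) ^ 2 :=
    variance_le_sq_of_bounded (ae_of_all _ hf01) hf.aemeasurable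
  have hch := meas_ge_le_variance_div_sq (memLp_finsetSum' Finset.univ fun k _ => hLk k)
    (c := n * ε / 2) (by positivity)
  rw [hmean, hvar] at hch
  simp only [Finset.sum_apply, Finset.sum_const, Finset.card_univ, Fintype.card_fin,
    nsmul_eq_mul] at hch
  refine hch.trans ?_
  have : (1 / 2 : ENNReal) = ENNReal.ofReal (1 / 2) := by
    rw [ENNReal.ofReal_div_of_pos (by norm_num)]; simp
  rw [this]
  refine ENNReal.ofReal_le_ofReal ?_
  -- The variance of the sum is at most `n / 4`, and `n / 4 ≤ (n ε / 2)² / 2` is exactly `2 ≤ n ε²`.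
  rw [div_le_iff₀ (by positivity)]
  nlinarith

/-- Symmetrization by a ghost sample. -/
theorem measure_exists_abs_sum_sub_le {X : Type*} [MeasurableSpace X] {n : ℕ}
    {P : Measure X} [IsProbabilityMeasure P] {F : Set (X → ℝ)} (hFm : ∀ f ∈ F, Measurable f)
    (hF01 : ∀ f ∈ F, ∀ x, f x ∈ Set.Icc (0 : ℝ) 1) {ε : ℝ} (hε : 0 < ε)
    (hnε : 2 ≤ n * ε ^ 2) :
    (Measure.pi fun _ : Fin n => P) {S | ∃ f ∈ F, n * ε < |∑ k, f (S k) - n * ∫ x, f x ∂P|}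
      ≤ 2 * (Measure.pi fun _ : Fin n ⊕ Fin n => P)
        {s | ∃ f ∈ F, n * ε / 2 < |∑ i, (f (s (.inl i)) - f (s (.inr i)))|} := by
  set μ := Measure.pi fun _ : Fin n => P
  set B := {s : Fin n ⊕ Fin n → X |
    ∃ f ∈ F, n * ε / 2 < |∑ i, (f (s (.inl i)) - f (s (.inr i)))|} with hB
  set ν := Measure.pi fun _ : Fin n ⊕ Fin n => P
  -- `B` need not be measurable here; a measurable hull of equal measure allows Fubini.
  set B' := toMeasurable ν B
  have hB'm : MeasurableSet B' := measurableSet_toMeasurable _ _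
  have hmp := measurePreserving_sumPiEquivProdPi_symm (fun _ : Fin n ⊕ Fin n => P)
  set E := (MeasurableEquiv.sumPiEquivProdPi fun _ : Fin n ⊕ Fin n => X).symm
  have hEm : MeasurableSet (E ⁻¹' B') := E.measurable hB'm
  have hν : ∫⁻ S, μ (Prod.mk S ⁻¹' (E ⁻¹' B')) ∂μ = ν B := by
    rw [← Measure.prod_apply hEm, ← measure_toMeasurable B]
    exact hmp.measure_preimage hB'm.nullMeasurableSet
  have hsub : {S | ∃ f ∈ F, n * ε < |∑ k, f (S k) - n * ∫ x, f x ∂P|}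
      ⊆ {S | 1 / 2 ≤ μ (Prod.mk S ⁻¹' (E ⁻¹' B'))} := by
    -- For the `f` that deviates on `S`, a ghost sample is within `n ε / 2` of the mean with
    -- probability at least `1/2`, and then the two sums differ by more than `n ε / 2`. Markov's
    -- inequality concludes.
    rintro S ⟨f, hf, hS⟩
    set Q := {S' : Fin n → X | n * ε / 2 ≤ |∑ k, f (S' k) - n * ∫ x, f x ∂P|} with hQ
    have hQm : MeasurableSet Q := by
      have hfm := hFm f hf
      exact measurableSet_le measurable_const (by fun_prop)
    have hQle : μ Q ≤ 1 / 2 := measure_half_le_abs_sum_sub_le (hFm f hf) (hF01 f hf) hε hnε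
    have hQc : Qᶜ ⊆ Prod.mk S ⁻¹' (E ⁻¹' B') := by
      intro S' hS'
      refine subset_toMeasurable ν B ⟨f, hf, ?_⟩
      have e : ∑ i, (f (E (S, S') (.inl i)) - f (E (S, S') (.inr i)))
          = ∑ i, f (S i) - ∑ i, f (S' i) := by
        rw [← Finset.sum_sub_distrib]; rfl
      rw [e]
      have h1 : |∑ k, f (S' k) - n * ∫ x, f x ∂P| < n * ε / 2 := not_le.1 hS'
      have h2 := abs_sub_abs_le_abs_sub (∑ k, f (S k) - n * ∫ x, f x ∂P)
        (∑ k, f (S' k) - n * ∫ x, f x ∂P)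
      rw [sub_sub_sub_cancel_right] at h2
      linarith
    calc (1 / 2 : ENNReal) = 1 - 1 / 2 := by simp
      _ ≤ 1 - μ Q := tsub_le_tsub_left hQle 1
      _ = μ Qᶜ := (prob_compl_eq_one_sub hQm).symm
      _ ≤ _ := measure_mono hQc
  have hmk := mul_meas_ge_le_lintegral (μ := μ) (measurable_measure_prodMk_left (ν := μ) hEm) (1 / 2)
  calc _ ≤ μ {S | 1 / 2 ≤ μ (Prod.mk S ⁻¹' (E ⁻¹' B'))} := measure_mono hsub
    _ = 2 * (1 / 2 * μ {S | 1 / 2 ≤ μ (Prod.mk S ⁻¹' (E ⁻¹' B'))}) := by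
        rw [← mul_assoc, one_div, ENNReal.mul_inv_cancel (by simp) (by simp), one_mul]
    _ ≤ 2 * ν B := by rw [← hν]; gcongr

/-! ### Argmax, distilled risk and the Bayes classifier -/

theorem argmaxLast_eq_iff {m : ℕ} [NeZero m] (p : Fin m → ℝ) (i : Fin m) :
    argmaxLast p = i ↔ (∀ j, p j ≤ p i) ∧ ∀ k, (∀ j, p j ≤ p k) → k ≤ i := by
  unfold argmaxLast
  rw [Finset.max'_eq_iff]
  simp

theorem le_argmaxLast {m : ℕ} [NeZero m] (p : Fin m → ℝ) (j : Fin m) : p j ≤ p (argmaxLast p) :=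
  ((argmaxLast_eq_iff p _).1 rfl).1 j

theorem iSup_eq_argmaxLast {m : ℕ} [NeZero m] (p : Fin m → ℝ) : ⨆ i, p i = p (argmaxLast p) :=
  le_antisymm (ciSup_le (le_argmaxLast p)) (le_ciSup (Set.finite_range p).bddAbove _)

theorem measurable_argmaxLast {m : ℕ} [NeZero m] :
    Measurable (argmaxLast : (Fin m → ℝ) → Fin m) := by
  refine measurable_to_countable' fun i => ?_
  have hA : ∀ k : Fin m, MeasurableSet {p : Fin m → ℝ | ∀ j, p j ≤ p k} := fun k => by
    rw [Set.ofPred_forall]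
    exact MeasurableSet.iInter fun j =>
      measurableSet_le (measurable_pi_apply j) (measurable_pi_apply k)
  have : argmaxLast ⁻¹' {i} = {p : Fin m → ℝ | ∀ j, p j ≤ p i} ∩
      ⋂ k, ({p : Fin m → ℝ | ∀ j, p j ≤ p k}ᶜ ∪ {_p | k ≤ i}) := by
    ext p
    simp only [Set.mem_preimage, Set.mem_singleton_iff, argmaxLast_eq_iff, Set.mem_inter_iff,
      Set.mem_iInter, Set.mem_union, Set.mem_compl_iff, Set.mem_ofPred_eq, imp_iff_not_or]
  rw [this]
  exact (hA i).inter (MeasurableSet.iInter fun k => (hA k).compl.union (MeasurableSet.const _))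

/-- The loss is one minus the teacher's probability of the predicted label. -/
theorem distilledLoss_eq {X : Type u} {m : ℕ} (p : X → stdSimplex ℝ (Fin m)) (h : X → Fin m)
    (x : X) : distilledLoss p h x = 1 - (p x).1 (h x) := by
  have e : ∀ i, (p x).1 i * (if h x ≠ i then 1 else 0)
      = (p x).1 i - if h x = i then (p x).1 i else 0 := fun i => by
    by_cases hi : h x = i <;> simp [hi]
  simp only [distilledLoss, e, Finset.sum_sub_distrib, (p x).2.2]
  simp

theorem distilledLoss_mem_Icc {X : Type u} {m : ℕ} (p : X → stdSimplex ℝ (Fin m)) (h : X → Fin m)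
    (x : X) : distilledLoss p h x ∈ Set.Icc (0 : ℝ) 1 := by
  have h1 := (mem_Icc_of_mem_stdSimplex (p x).2 (h x))
  rw [distilledLoss_eq]
  exact ⟨by linarith [h1.2], by linarith [h1.1]⟩

section

variable {X : Type u} [MeasurableSpace X] {m : ℕ}

theorem measurable_coord {p : X → stdSimplex ℝ (Fin m)} (hp : Measurable p) (i : Fin m) :
    Measurable fun x => (p x).1 i :=
  (measurable_pi_apply i).comp (measurable_subtype_coe.comp hp)

theorem measurable_condClassProb [NeZero m] (D : Measure (X × Fin m)) [IsFiniteMeasure D] :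
    Measurable (condClassProb D) :=
  Measurable.subtype_mk (measurable_pi_lambda _ fun y =>
    (Kernel.measurable_coe D.condKernel (measurableSet_singleton y)).ennreal_toReal)

theorem measurable_bayes [NeZero m] (D : Measure (X × Fin m)) [IsFiniteMeasure D] :
    Measurable (bayes D) :=
  measurable_argmaxLast.comp (measurable_subtype_coe.comp (measurable_condClassProb D))

theorem measurable_distilledLoss {p : X → stdSimplex ℝ (Fin m)} (hp : Measurable p)
    {h : X → Fin m} (hh : Measurable h) : Measurable (distilledLoss p h) := by
  have h1 : Measurable fun z : X × Fin m => (p z.1).1 z.2 :=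
    measurable_from_prod_countable_left (measurable_coord hp)
  have h2 : distilledLoss p h = fun x => 1 - (p x).1 (h x) := funext (distilledLoss_eq p h)
  rw [h2]
  exact measurable_const.sub (h1.comp (measurable_id.prodMk hh))

theorem integrable_distilledLoss (P : Measure X) [IsFiniteMeasure P]
    {p : X → stdSimplex ℝ (Fin m)} (hp : Measurable p) {h : X → Fin m} (hh : Measurable h) :
    Integrable (distilledLoss p h) P :=
  Integrable.of_mem_Icc 0 1 (measurable_distilledLoss hp hh).aemeasurable
    (ae_of_all _ (distilledLoss_mem_Icc p h))

theorem distilledRisk_nonneg (P : Measure X) (p : X → stdSimplex ℝ (Fin m)) (h : X → Fin m) :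
    0 ≤ distilledRisk P p h :=
  integral_nonneg fun x => (distilledLoss_mem_Icc p h x).1

/-- The risk is the distilled risk of the teacher that knows the conditional class
probabilities. -/
theorem risk_eq_distilledRisk [NeZero m] (D : Measure (X × Fin m)) [IsProbabilityMeasure D]
    {h : X → Fin m} (hh : Measurable h) :
    risk D h = distilledRisk D.fst (condClassProb D) h := by
  have hm : Measurable fun z : X × Fin m => if h z.1 ≠ z.2 then (1 : ℝ) else 0 :=
    Measurable.ite (measurableSet_eq_fun (hh.comp measurable_fst) measurable_snd).compl
      measurable_const measurable_const
  have hi : Integrable (fun z : X × Fin m => if h z.1 ≠ z.2 then (1 : ℝ) else 0) D :=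
    Integrable.of_mem_Icc 0 1 hm.aemeasurable (ae_of_all _ fun z => by
      split_ifs <;> simp)
  rw [risk, ← Measure.integral_condKernel hi, distilledRisk]
  refine integral_congr_ae (ae_of_all _ fun x => ?_)
  dsimp only
  rw [integral_fintype Integrable.of_finite]
  rfl

/-- The excess risk of a classifier is at most its excess distilled risk over the Bayes-optimal
classifier, up to the distance of the teacher to a transformation of the conditional class
probabilities that keeps their argmax and does not shrink their margins. -/
theorem risk_sub_risk_bayes_le [NeZero m] (D : Measure (X × Fin m)) [IsProbabilityMeasure D]
    {pt : X → stdSimplex ℝ (Fin m)} (hpt : Measurable pt) {q : X → stdSimplex ℝ (Fin m)}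
    (hq : AEMeasurable q D.fst)
    (hq1 : ∀ᵐ x ∂D.fst, argmaxLast (q x).1 = argmaxLast (condClassProb D x).1)
    (hq2 : ∀ᵐ x ∂D.fst, ∀ j : Fin m,
      (⨆ i, (condClassProb D x).1 i) - (condClassProb D x).1 j ≤ (⨆ i, (q x).1 i) - (q x).1 j)
    {h : X → Fin m} (hh : Measurable h) :
    risk D h - risk D (bayes D) ≤
      distilledRisk D.fst pt h - distilledRisk D.fst pt (bayes D)
        + ∫ x, ∑ i, |(pt x).1 i - (q x).1 i| ∂D.fst := by
  have hb := measurable_bayes D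
  have hc := measurable_condClassProb D
  have i1 := integrable_distilledLoss D.fst hc hh
  have i2 := integrable_distilledLoss D.fst hc hb
  have i3 := integrable_distilledLoss D.fst hpt hh
  have i4 := integrable_distilledLoss D.fst hpt hb
  have i5 : Integrable (fun x => ∑ i, |(pt x).1 i - (q x).1 i|) D.fst := by
    refine integrable_finsetSum _ fun i _ => ?_
    refine Integrable.of_mem_Icc 0 1 ?_ (ae_of_all _ fun x => ⟨abs_nonneg _, ?_⟩)
    · have h1 : AEMeasurable (fun x => (q x).1 i) D.fst :=
        ((measurable_pi_apply i).comp measurable_subtype_coe).comp_aemeasurable hq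
      exact ((measurable_coord hpt i).aemeasurable.sub h1).norm
    · have h1 := mem_Icc_of_mem_stdSimplex (pt x).2 i
      have h2 := mem_Icc_of_mem_stdSimplex (q x).2 i
      exact abs_le.2 ⟨by linarith [h1.1, h2.2], by linarith [h1.2, h2.1]⟩
  rw [risk_eq_distilledRisk D hh, risk_eq_distilledRisk D hb]
  simp only [distilledRisk]
  have i6 : Integrable (fun x => distilledLoss pt h x - distilledLoss pt (bayes D) x) D.fst :=
    i3.sub i4
  rw [← integral_sub i1 i2, ← integral_sub i3 i4, ← integral_add i6 i5]
  refine integral_mono_ae (i1.sub i2) (i6.add i5) ?_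
  filter_upwards [hq1, hq2] with x h1 h2
  have h3 := h2 (h x)
  rw [iSup_eq_argmaxLast, iSup_eq_argmaxLast, h1] at h3
  simp only [distilledLoss_eq]
  change (condClassProb D x).1 (bayes D x) - _ ≤ (q x).1 (bayes D x) - _ at h3
  -- Two distinct labels give two separate terms of the ℓ¹ sum; equal labels make both excess losses
  -- vanish.
  by_cases e : bayes D x = h x
  · have := Finset.sum_nonneg fun (i : Fin m) (_ : i ∈ Finset.univ) =>
      abs_nonneg ((pt x).1 i - (q x).1 i)
    rw [e]
    linarith
  · have h4 := Finset.add_le_sum (f := fun i => |(pt x).1 i - (q x).1 i|) (s := Finset.univ)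
      (fun i _ => abs_nonneg _) (Finset.mem_univ (bayes D x)) (Finset.mem_univ (h x)) e
    have h5 := neg_abs_le ((pt x).1 (bayes D x) - (q x).1 (bayes D x))
    have h6 := le_abs_self ((pt x).1 (h x) - (q x).1 (h x))
    linarith

end

/-! ### Uniform convergence and empirical risk minimization -/

/-- With `M = m n ≥ 2`, the pattern count is at most `M^(4d)` and the factor `4` at most `M^(2d)`.
The exponent `49/8 ≥ 6` absorbs `M^(6d)` and still leaves `δ`. -/
theorem growth_mul_exp_le {m n d : ℕ} (hm : 2 ≤ m) (hn : 0 < n) (hd : 1 ≤ d) {δ L : ℝ}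
    (hδ : 0 < δ) (hδ1 : δ < 1) (hL : L = d * Real.log (m * n) + Real.log (1 / δ)) :
    2 * (((((2 * n + 1) * m ^ 2) ^ d : ℕ) : ℝ) * (2 * Real.exp (-(49 / 8 * L)))) ≤ δ := by
  have hm' : (2 : ℝ) ≤ m := by exact_mod_cast hm
  have hn' : (1 : ℝ) ≤ n := by exact_mod_cast hn
  set M : ℝ := m * n with hM
  have hM2 : 2 ≤ M := by nlinarith
  have hK : ((((2 * n + 1) * m ^ 2) ^ d : ℕ) : ℝ) ≤ (M ^ 4) ^ d := by
    push_cast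
    gcongr
    have e : M ^ 4 = (m : ℝ) ^ 2 * n ^ 4 * m ^ 2 := by rw [hM]; ring
    rw [e]
    gcongr
    have h1 : (n : ℝ) ≤ n ^ 4 := le_self_pow₀ hn' (by norm_num)
    nlinarith
  have h4 : (4 : ℝ) ≤ (M ^ 2) ^ d :=
    (by nlinarith : (4 : ℝ) ≤ M ^ 2).trans (le_self_pow₀ (by nlinarith) (by omega))
  have hexp : (M ^ 2) ^ d * (M ^ 4) ^ d = Real.exp (6 * (d * Real.log M)) := by
    rw [← mul_pow, ← pow_add, ← pow_mul, ← Real.exp_log (show (0 : ℝ) < M by linarith),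
      ← Real.exp_nat_mul, Real.log_exp]
    congr 1
    push_cast
    ring
  have hlM : 0 ≤ d * Real.log M := mul_nonneg (Nat.cast_nonneg _) (Real.log_nonneg (by linarith))
  have hld : 0 ≤ Real.log (1 / δ) := Real.log_nonneg (by rw [le_div_iff₀ hδ]; linarith)
  calc 2 * (((((2 * n + 1) * m ^ 2) ^ d : ℕ) : ℝ) * (2 * Real.exp (-(49 / 8 * L))))
      = 4 * ((((2 * n + 1) * m ^ 2) ^ d : ℕ) : ℝ) * Real.exp (-(49 / 8 * L)) := by ring
    _ ≤ (M ^ 2) ^ d * (M ^ 4) ^ d * Real.exp (-(49 / 8 * L)) := by gcongr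
    _ = Real.exp (6 * (d * Real.log M) + -(49 / 8 * L)) := by rw [hexp, Real.exp_add]
    _ ≤ Real.exp (-Real.log (1 / δ)) := Real.exp_le_exp.2 (by rw [hL]; linarith)
    _ = δ := by rw [Real.log_div one_ne_zero hδ.ne', Real.log_one, zero_sub, neg_neg,
        Real.exp_log hδ]

/-- Uniform convergence of the empirical distilled risks over a class of finite Natarajan
dimension. -/
theorem measure_exists_deviation_le {X : Type u} [MeasurableSpace X] {m : ℕ} [NeZero m]
    (hm : 2 ≤ m) {P : Measure X} [IsProbabilityMeasure P] {pt : X → stdSimplex ℝ (Fin m)}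
    (hpt : Measurable pt) {H : Set (X → Fin m)} (hH : ∀ h ∈ H, Measurable h)
    (hHm : IsMeasurableClass P (distilledLoss pt '' H)) {d : ℕ} (hd : natarajanDim H = d)
    (hd1 : 1 ≤ d) {n : ℕ} (hn : 0 < n) {δ : ℝ} (hδ : 0 < δ) (hδ1 : δ < 1) :
    (Measure.pi fun _ : Fin n => P) {S | ∃ h ∈ H,
      n * (7 * Real.sqrt ((d * Real.log (m * n) + Real.log (1 / δ)) / n))
        < |∑ k, distilledLoss pt h (S k) - n * distilledRisk P pt h|} ≤ ENNReal.ofReal δ := by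
  classical
  have hm' : (2 : ℝ) ≤ m := by exact_mod_cast hm
  have hn' : (1 : ℝ) ≤ n := by exact_mod_cast hn
  have hd' : (1 : ℝ) ≤ d := by exact_mod_cast hd1
  have hld : 0 ≤ Real.log (1 / δ) := Real.log_nonneg (by rw [le_div_iff₀ hδ]; linarith)
  have hlm : 1 / 2 ≤ Real.log (m * n) := by
    have h1 : Real.log 2 ≤ Real.log (m * n) := Real.log_le_log (by norm_num) (by nlinarith)
    linarith [Real.log_two_gt_d9]
  set L := d * Real.log (m * n) + Real.log (1 / δ) with hL
  -- Secures `2 ≤ n ε² = 49 L` for the Chebyshev step; this is where `m ≥ 2` and `d ≥ 1` enter.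
  have hL2 : 1 / 2 ≤ L := by nlinarith
  set ε := 7 * Real.sqrt (L / n) with hε
  have hε0 : 0 < ε := by positivity
  have hε2 : n * ε ^ 2 = 49 * L := by
    rw [hε, mul_pow, Real.sq_sqrt (by positivity)]
    field_simp
    norm_num
  have hF01 : ∀ f ∈ distilledLoss pt '' H, ∀ x, f x ∈ Set.Icc (0 : ℝ) 1 := by
    rintro _ ⟨h, -, rfl⟩ x
    exact distilledLoss_mem_Icc pt h x
  have hK : ∀ s : Fin n ⊕ Fin n → X, ∃ G : Finset (X → ℝ),
      (∀ g ∈ G, g ∈ distilledLoss pt '' H) ∧ G.card ≤ ((2 * n + 1) * m ^ 2) ^ d ∧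
        ∀ f ∈ distilledLoss pt '' H, ∃ g ∈ G, ∀ i, g (s i) = f (s i) := by
    intro s
    obtain ⟨G, hG, hGc, hcov⟩ := exists_cover_of_nshatters_card_le (Finset.univ.image s) H d
      (fun T _ hT => hT.card_le hd)
    refine ⟨G.image (distilledLoss pt), ?_, ?_, ?_⟩
    · intro g hg
      obtain ⟨h, hh, rfl⟩ := Finset.mem_image.1 hg
      exact ⟨h, hG h hh, rfl⟩
    · refine Finset.card_image_le.trans (hGc.trans ?_)
      have : (Finset.univ.image s).card ≤ 2 * n :=
        Finset.card_image_le.trans (by simp [two_mul])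
      gcongr
    · rintro _ ⟨h, hh, rfl⟩
      obtain ⟨g, hg, hgh⟩ := hcov h hh
      refine ⟨_, Finset.mem_image_of_mem _ hg, fun i => ?_⟩
      rw [distilledLoss_eq, distilledLoss_eq, hgh _ (Finset.mem_image_of_mem s (Finset.mem_univ i))]
  have h1 := measure_exists_abs_sum_sub_le (n := n) (P := P) (F := distilledLoss pt '' H)
    (by rintro _ ⟨h, hh, rfl⟩; exact measurable_distilledLoss hpt (hH h hh)) hF01 hε0
    (by rw [hε2]; linarith)
  have h2 := measure_double_sample_le hn hHm hF01 hK (t := n * ε / 2) (by positivity)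
  have e : -(n * ε / 2) ^ 2 / (2 * n) = -(49 / 8 * L) := by
    have : 49 / 8 * L = n * ε ^ 2 / 8 := by rw [hε2]; ring
    rw [this]
    field_simp
    norm_num
  rw [e] at h2
  simp only [Set.exists_mem_image] at h1 h2
  refine h1.trans ((mul_le_mul_right h2 2).trans ?_)
  rw [← ENNReal.ofReal_ofNat, ← ENNReal.ofReal_mul (by norm_num)]
  exact ENNReal.ofReal_le_ofReal (growth_mul_exp_le hm hn hd1 hδ hδ1 hL)

/-- A class of classifiers into one label, or of Natarajan dimension zero, has at most one
member. -/
theorem subsingleton_of_natarajanDim {X : Type u} {m : ℕ} {H : Set (X → Fin m)} {d : ℕ}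
    (hd : natarajanDim H = d) (h : m < 2 ∨ d = 0) : H.Subsingleton := by
  intro f hf g hg
  funext x
  rcases h with h | rfl
  · exact Fin.ext (by omega)
  · by_contra hne
    simpa using (nshatters_singleton hf hg hne).card_le hd

/-- Compare with each `g` in `H` separately, paying `ε` at `h` and `ε` at `g`; the infimum need not
be attained. -/
theorem IsERM.distilledRisk_sub_iInf_le {X : Type u} [MeasurableSpace X] {m n : ℕ} (hn : 0 < n)
    {P : Measure X} {pt : X → stdSimplex ℝ (Fin m)} {H : Set (X → Fin m)} {S : Fin n → X} {ε : ℝ}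
    (hS : ∀ h ∈ H, |∑ k, distilledLoss pt h (S k) - n * distilledRisk P pt h| ≤ n * ε)
    {h : X → Fin m} (hh : IsERM H pt S h) :
    distilledRisk P pt h - ⨅ g : H, distilledRisk P pt g.1 ≤ 2 * ε := by
  have hn' : (0 : ℝ) < n := by exact_mod_cast hn
  have : Nonempty H := ⟨⟨h, hh.1⟩⟩
  have key : distilledRisk P pt h - 2 * ε ≤ ⨅ g : H, distilledRisk P pt g.1 := by
    refine le_ciInf fun g => ?_
    have h1 := (abs_le.1 (hS h hh.1)).1
    have h2 := (abs_le.1 (hS g.1 g.2)).2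
    have h3 := le_of_mul_le_mul_left (hh.2 g.1 g.2) (by positivity : (0 : ℝ) < 1 / n)
    refine le_of_mul_le_mul_left ?_ hn'
    linarith
  linarith

end Distill

/-! ### The student's excess risk bound -/

theorem mainTheorem2 :
    ∃ C : ℝ, 0 < C ∧
      ∀ (X : Type u) [MeasurableSpace X] (m : ℕ) [NeZero m]
        (D : Measure (X × Fin m)) [IsProbabilityMeasure D]
        (pt : X → stdSimplex ℝ (Fin m)) (_ : Measurable pt)
        (φ : stdSimplex ℝ (Fin m) → stdSimplex ℝ (Fin m))
        (_ : AEMeasurable (fun x => φ (Distill.condClassProb D x)) D.fst)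
        (_ : ∀ᵐ x ∂D.fst,
          Distill.argmaxLast (φ (Distill.condClassProb D x)).1
            = Distill.argmaxLast (Distill.condClassProb D x).1)
        (_ : ∀ᵐ x ∂D.fst, ∀ j : Fin m,
          (⨆ i, (Distill.condClassProb D x).1 i) - (Distill.condClassProb D x).1 j
            ≤ (⨆ i, (φ (Distill.condClassProb D x)).1 i) - (φ (Distill.condClassProb D x)).1 j)
        (H : Set (X → Fin m)) (_ : ∀ h ∈ H, Measurable h)
        (_ : Distill.IsMeasurableClass D.fst (Distill.distilledLoss pt '' H))
        (d : ℕ) (_ : Distill.natarajanDim H = d)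
        (n : ℕ) (_ : 0 < n) (δ : ℝ) (_ : 0 < δ) (_ : δ < 1),
        -- The bad event has outer probability at most `δ`: its complement contains a measurable
        -- event of probability at least `1 - δ`.
        (Measure.pi fun _ : Fin n => D.fst)
          {S | ¬ ∀ h, Distill.IsERM H pt S h →
            Distill.risk D h - Distill.risk D (Distill.bayes D) ≤
              C * Real.sqrt ((d * Real.log (m * n) + Real.log (1 / δ)) / n)
              + ((⨅ g : H, Distill.distilledRisk D.fst pt g.1)
                - ⨅ g : {g : X → Fin m // Measurable g}, Distill.distilledRisk D.fst pt g.1)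
              + ∫ x, ∑ i, |(pt x).1 i - (φ (Distill.condClassProb D x)).1 i| ∂D.fst}
          ≤ ENNReal.ofReal δ := by
  -- Twice the deviation constant `7`.
  refine ⟨14, by norm_num, ?_⟩
  intro X _ m _ D _ pt hpt φ hφ hφ1 hφ2 H hH hHm d hd n hn δ hδ hδ1
  have hmain : ∀ h ∈ H, ∀ r : ℝ,
      Distill.distilledRisk D.fst pt h - ⨅ g : H, Distill.distilledRisk D.fst pt g.1 ≤ r →
      Distill.risk D h - Distill.risk D (Distill.bayes D) ≤ r
        + ((⨅ g : H, Distill.distilledRisk D.fst pt g.1)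
          - ⨅ g : {g : X → Fin m // Measurable g}, Distill.distilledRisk D.fst pt g.1)
        + ∫ x, ∑ i, |(pt x).1 i - (φ (Distill.condClassProb D x)).1 i| ∂D.fst := by
    intro h hh r hr
    have h1 := Distill.risk_sub_risk_bayes_le D hpt hφ hφ1 hφ2 (hH h hh)
    have h2 : ⨅ g : {g : X → Fin m // Measurable g}, Distill.distilledRisk D.fst pt g.1
        ≤ Distill.distilledRisk D.fst pt (Distill.bayes D) :=
      ciInf_le ⟨0, by rintro _ ⟨g, rfl⟩; exact Distill.distilledRisk_nonneg _ _ _⟩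
        (⟨_, Distill.measurable_bayes D⟩ : {g : X → Fin m // Measurable g})
    linarith
  -- Here the square root may be too small for symmetrization, but `H` has at most one member, so
  -- the estimation error is zero and the bad event is empty.
  by_cases hcase : m < 2 ∨ d = 0
  · have hs := Distill.subsingleton_of_natarajanDim hd hcase
    rw [show {S : Fin n → X | _} = ∅ from ?_, measure_empty]
    · exact zero_le
    · refine Set.eq_empty_of_forall_notMem fun S hS => hS fun h hh => ?_
      refine hmain h hh.1 _ ?_
      have : Unique H := ⟨⟨⟨h, hh.1⟩⟩, fun g => Subtype.ext (hs g.2 hh.1)⟩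
      rw [ciInf_unique]
      have e : ((default : H) : X → Fin m) = h := hs (default : H).2 hh.1
      rw [e, sub_self]
      positivity
  · push Not at hcase
    refine (measure_mono fun S hS => ?_).trans (Distill.measure_exists_deviation_le hcase.1 hpt hH
      hHm hd (Nat.one_le_iff_ne_zero.2 hcase.2) hn hδ hδ1)
    by_contra hgood
    refine hS fun h hh => hmain h hh.1 _ ?_
    have h1 := hh.distilledRisk_sub_iInf_le (P := D.fst) hn
      (ε := 7 * Real.sqrt ((d * Real.log (m * n) + Real.log (1 / δ)) / n))
      (fun g hg => not_lt.1 fun hlt => hgood ⟨g, hg, hlt⟩)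
    linarith
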